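/- Let $G$ be a finite Abelian group of unitary symmetries, with a decomposition $G\cong\prod_i\mathbb Z_{N_i}$ and generators $e_i$, let $\lambda\in Z^2(G,\mathbb Z_2)$ be a 2-cocycle (determining the fermionic symmetry group $G_f$ as a central extension of $G$ by fermion parity), and let $\nu=4k+2$ with $k\in\mathbb Z$. Put $\Omega_i=\sum_{n=0}^{N_i-1}\lambda(ne_i,e_i)$ and $\Omega_{ij}=\lambda(e_i,e_j)-\lambda(e_j,e_i)$ modulo 2, and assume that $\lambda$ is of type I, i.e. $\Omega_{ij}=0$ for all $i,j$. *Definitions.* For cochains $n_1:G\to\mathbb Z_2$ and $n_2:G^2\to\mathbb Z_2$ put $$\mathcal O_2=\nu\lambda,\qquad \mathcal O_3[\nu,\lambda,n_1]=\lambda\cup n_1+\tfrac{\nu}{2}\,\lambda\cup_1\lambda \pmod 2,$$ where $(\lambda\cup n_1)(g,h,k)=\lambda(g,h)n_1(k)$ and $(\lambda\cup_1\lambda)(g,h,k)=\lambda(h,k)\lambda(g,hk)-\lambda(g,h)\lambda(gh,k)$. The four anyons $1,v,f,vf$ obtained by gauging fermion parity are labelled $0,1,2,3$ and form $\mathbb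 Z_4$; with $[\cdot]$ the residue modulo 4, $F_{x,y,z}=e^{i\pi\nu x(y+z-[y+z])/8}$ and $R_{x,y}=e^{i\pi\nu xy/8}$. With $w=v^{\lambda}f^{n_2}$, i.e. $w=\lambda+2n_2\in\mathbb Z_4$, let $$\mathcal O_4^A[\lambda,n_2](g,h,k,l)=R_{w(k,l),w(g,h)}\frac{F_{w(h,k),w(g,hk),w(ghk,l)}}{F_{w(h,k),w(hk,l),w(g,hkl)}}\cdot\frac{F_{w(g,h),w(k,l),w(gh,kl)}}{F_{w(g,h),w(gh,k),w(ghk,l)}}\cdot\frac{F_{w(k,l),w(h,kl),w(g,hkl)}}{F_{w(k,l),w(g,h),w(gh,kl)}},$$ the obstruction of a chiral state with $n_1=0$. The obstruction of a nonchiral state with data $n_2$ is, with $\mathrm dn_2$ taken in $\{0,1\}$, $$\mathcal O_4^B[\lambda,n_2](g,h,k,l)=(-1)^{(\lambda\cup n_2+n_2\cup n_2+n_2\cup_1\mathrm dn_2)(g,h,k,l)+\lambda(g,hk)\,\mathrm dn_2(h,k,l)+\mathrm dn_2(g,h,kl)\,\mathrm dn_2(gh,k,l)}\,(-i)^{\mathrm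 dn_2(g,h,k)[1-\mathrm dn_2(g,h,kl)]},$$ where $(n_2\cup_1\mathrm dn_2)(g,h,k,l)=n_2(ghk,l)\,\mathrm dn_2(g,h,k)+n_2(g,hkl)\,\mathrm dn_2(h,k,l)$. A *valid symmetry-enriched invertible topological order (iTO)* for $(\nu,\lambda)$ consists of cochains $n_1$, $n_2^A$, $n_2^B$ with $\mathrm dn_1=\mathcal O_2$, $\mathrm dn_2^A=\mathcal O_3[\nu,\lambda,0]$ and $\mathrm dn_2^B=\mathcal O_3[0,\lambda,n_1]=\lambda\cup n_1$, such that $\mathcal O_4^A[\lambda,n_2^A]\cdot\mathcal O_4^B[\lambda,n_2^B]$ is a $U(1)$-valued 4-coboundary. *Enforced symmetry breaking (ESB)* occurs if there is no valid symmetry-enriched iTO. *Statement.* 1. ESB does not occur for $(\nu,\lambda)$. There is even a valid symmetry-enriched iTO with $n_1=0$ and $n_2^B=0$. 2. There is a 2-cocycle $\lambda'$ cohomologous to $\lambda$ for which one may take $n_1=n_2=0$: $\mathcal O_3[\nu,\lambda',0]=0$ identically, $\mathcal O_4^A[\lambda',0]=e^{i\nu\pi(\lambda'\cup\lambda')/8}$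 (with $\lambda'$ valued in $\{0,1\}\subset\mathbb Z$), this is a $U(1)$-valued 4-coboundary, and $n_1=n_2^A=n_2^B=0$ is a valid symmetry-enriched iTO for $(\nu,\lambda')$. 3. Let $w_i(a,b)=\frac1{N_i}\big(a_i+b_i-[a_i+b_i]_{N_i}\big)$, where $a_i\in\{0,\dots,N_i-1\}$ are the coordinates of $a\in G$, and let $\Lambda=\sum_i\Omega_iw_i$, a sum of integers with $\Omega_i\in\{0,1\}$ and no reduction modulo 2. Then $\lambda_0=\Lambda\bmod 2$ is cohomologous to $\lambda$, $\Lambda$ is an integral 2-cocycle, and $e^{i\nu\pi(\Lambda\cup\Lambda)/8}$ is a $U(1)$-valued 4-coboundary. With $n_2=\lfloor\Lambda/2\rfloor\bmod 2$ (that is, $w=v^{\Lambda}$; this is $n_2=0$ when $\Lambda$ takes only the values $0,1$), $n_1=0$, $n_2^A=n_2$, $n_2^B=0$ is a valid symmetry-enriched iTO for $(\nu,\lambda_0)$, and $\mathcal O_4^A[\lambda_0,n_2]=e^{i\nu\pi(\Lambda\cup\Lambda)/8}$ whenever $\Lambda<4$ everywhere. -/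

import Mathlib

open scoped BigOperators

noncomputable section

namespace ITO

/-! Inhomogeneous group cochains with trivial action. -/

section Cochains

variable {G : Type*} [Group G] {M : Type*} [AddCommGroup M]

/-- Coboundary of a 1-cochain. -/
def d1 (f : G → M) : G → G → M := fun g h => f h - f (g * h) + f g

/-- Coboundary of a 2-cochain. -/
def d2 (f : G → G → M) : G → G → G → M :=
  fun g h k => f h k - f (g * h) k + f g (h * k) - f g h

/-- 2-cocycles with values in `M`. -/
def IsCocycle2 (f : G → G → M) : Prop := ∀ g h k, d2 f g h k = 0

/-- Two 2-cochains differ by a coboundary. -/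
def Cohomologous2 (f f' : G → G → M) : Prop :=
  ∃ ε : G → M, ∀ g h, f' g h = f g h + d1 ε g h

/-- A `U(1)`-valued 4-cochain (written multiplicatively) is a 4-coboundary. -/
def IsCoboundary4 (ω : G → G → G → G → Circle) : Prop :=
  ∃ α : G → G → G → Circle, ∀ g h k l,
    ω g h k l =
      α h k l * (α (g * h) k l)⁻¹ * α g (h * k) l * (α g h (k * l))⁻¹ * α g h k

end Cochains

/-! Obstruction functions. Throughout, `lam` is the `ℤ/2`-valued 2-cocycle that determines the
fermionic symmetry group as an extension of the bosonic symmetry group `G`. -/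

section Obstructions

variable {G : Type*} [Group G]

/-- The first obstruction, `ν λ` modulo 2. -/
def O2 (ν : ℤ) (lam : G → G → ZMod 2) : G → G → ZMod 2 :=
  fun g h => (ν : ZMod 2) * lam g h

/-- The cup product of a 2-cochain and a 1-cochain, `λ ∪ n₁`. -/
def cup21 (lam : G → G → ZMod 2) (n1 : G → ZMod 2) : G → G → G → ZMod 2 :=
  fun g h k => lam g h * n1 k

/-- The cup-1 square `λ ∪₁ λ` of a 2-cochain. -/
def cupOneSq (lam : G → G → ZMod 2) : G → G → G → ZMod 2 :=
  fun g h k => lam h k * lam g (h * k) - lam g h * lam (g * h) k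

/-- The second obstruction `λ ∪ n₁ + (ν/2) λ ∪₁ λ`, for even `ν`. -/
def O3 (ν : ℤ) (lam : G → G → ZMod 2) (n1 : G → ZMod 2) : G → G → G → ZMod 2 :=
  fun g h k => cup21 lam n1 g h k + ((ν / 2 : ℤ) : ZMod 2) * cupOneSq lam g h k

/-- The `F` symbol of the topological order obtained by gauging fermion parity, for
`ν ≡ 2 mod 4`. The anyons `1, v, f, vf` are labelled `0, 1, 2, 3`; they fuse as `ℤ/4`. -/
def Fsymbol (ν : ℤ) (x y z : ZMod 4) : Circle :=
  Circle.exp (Real.pi * ν / 8 * ((x.val : ℝ) * ((y.val : ℝ) + z.val - (y + z).val)))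

/-- The `R` symbol of the same topological order. -/
def Rsymbol (ν : ℤ) (x y : ZMod 4) : Circle :=
  Circle.exp (Real.pi * ν / 8 * ((x.val : ℝ) * y.val))

/-- The symmetry fractionalization anyon `v ^ λ(g,h) * f ^ n₂(g,h)`. -/
def fracAnyon (lam n2 : G → G → ZMod 2) : G → G → ZMod 4 :=
  fun g h => (((lam g h).val + 2 * (n2 g h).val : ℕ) : ZMod 4)

/-- The defect obstruction of an abelian topological order whose anyons are not permuted, for the
symmetry fractionalization `w`, in terms of its `F` and `R` symbols. -/
def O4ofAnyon (ν : ℤ) (w : G → G → ZMod 4) : G → G → G → G → Circle :=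
  fun g h k l =>
    Rsymbol ν (w k l) (w g h)
      * (Fsymbol ν (w h k) (w g (h * k)) (w (g * h * k) l)
          / Fsymbol ν (w h k) (w (h * k) l) (w g (h * k * l)))
      * (Fsymbol ν (w g h) (w k l) (w (g * h) (k * l))
          / Fsymbol ν (w g h) (w (g * h) k) (w (g * h * k) l))
      * (Fsymbol ν (w k l) (w h (k * l)) (w g (h * k * l))
          / Fsymbol ν (w k l) (w g h) (w (g * h) (k * l)))

/-- The third obstruction for `ν ≡ 2 mod 4` and `n₁ = 0`. -/
def O4A (ν : ℤ) (lam n2 : G → G → ZMod 2) : G → G → G → G → Circle :=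
  O4ofAnyon ν (fracAnyon lam n2)

/-- The exponent of `-1` in the obstruction of a nonchiral (`ν = 0`) state:
`λ ∪ n₂ + n₂ ∪ n₂ + n₂ ∪₁ dn₂ + λ(g,hk) dn₂(h,k,l) + dn₂(g,h,kl) dn₂(gh,k,l)`. -/
def signExponentB (lam n2 : G → G → ZMod 2) (g h k l : G) : ZMod 2 :=
  lam g h * n2 k l + n2 g h * n2 k l
    + (n2 (g * h * k) l * d2 n2 g h k + n2 g (h * k * l) * d2 n2 h k l)
    + lam g (h * k) * d2 n2 h k l
    + d2 n2 g h (k * l) * d2 n2 (g * h) k l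

/-- The obstruction of a nonchiral (`ν = 0`) fermionic state with Majorana data `n₁` and data `n₂`
subject to `d n₂ = λ ∪ n₁`; it depends on `n₁` through `d n₂` only. The last factor is
`(-i) ^ (dn₂(g,h,k) (1 - dn₂(g,h,kl)) mod 2)`. -/
def O4B (lam n2 : G → G → ZMod 2) : G → G → G → G → Circle :=
  fun g h k l =>
    Circle.exp (Real.pi * ((signExponentB lam n2 g h k l).val : ℝ))
      * Circle.exp (-(Real.pi / 2) *
          ((d2 n2 g h k * (1 - d2 n2 g h (k * l))).val : ℝ))

/-- A valid (all obstructions trivial) symmetry-enriched invertible topological order of index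
`ν ≡ 2 mod 4`, for a symmetry `(G, λ)` whose `λ ∪₁ λ` is a coboundary: a chiral state of index `ν`
without Majorana data, stacked with a nonchiral state with Majorana data `n1`. -/
structure EnrichedITO (ν : ℤ) (lam : G → G → ZMod 2) where
  /-- the Majorana data -/
  n1 : G → ZMod 2
  /-- the second layer of data of the chiral state -/
  n2A : G → G → ZMod 2
  /-- the second layer of data of the nonchiral state -/
  n2B : G → G → ZMod 2
  d_n1 : ∀ g h, d1 n1 g h = O2 ν lam g h
  d_n2A : ∀ g h k, d2 n2A g h k = O3 ν lam 0 g h k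
  d_n2B : ∀ g h k, d2 n2B g h k = O3 0 lam n1 g h k
  O4_trivial : IsCoboundary4 fun g h k l => O4A ν lam n2A g h k l * O4B lam n2B g h k l

/-- Enforced symmetry breaking: there is no valid symmetry-enriched order. -/
def ESB (ν : ℤ) (lam : G → G → ZMod 2) : Prop := IsEmpty (EnrichedITO ν lam)

/-- The `U(1)`-valued 4-cochain `exp (i ν π (Λ ∪ Λ) / 8)`, for an integral 2-cochain `Λ`. -/
def expCupSq (ν : ℤ) (L : G → G → ℤ) : G → G → G → G → Circle :=
  fun g h k l => Circle.exp (ν * Real.pi * ((L g h : ℝ) * L k l) / 8)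

/-- The lift of a `ℤ/2`-valued 2-cochain to integers in `{0, 1}`. -/
def lift01 (lam : G → G → ZMod 2) : G → G → ℤ := fun g h => ((lam g h).val : ℤ)

end Obstructions

/-! Finite abelian groups with a chosen decomposition into cyclic groups. -/

section Abelian

variable {ι : Type*} [DecidableEq ι] {N : ι → ℕ} {G : Type*} [CommGroup G]

/-- The `i`-th cyclic generator. -/
def gen (φ : G ≃* Multiplicative (∀ i, ZMod (N i))) (i : ι) : G :=
  φ.symm (Multiplicative.ofAdd (Pi.single i 1))

/-- The invariant `Ω_i = ∑_{n < N_i} λ(n e_i, e_i)`. -/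
def Omega1 (φ : G ≃* Multiplicative (∀ i, ZMod (N i))) (lam : G → G → ZMod 2) (i : ι) : ZMod 2 :=
  ∑ n ∈ Finset.range (N i), lam (gen φ i ^ n) (gen φ i)

/-- The invariant `Ω_ij = λ(e_i, e_j) - λ(e_j, e_i)`. -/
def Omega2 (φ : G ≃* Multiplicative (∀ i, ZMod (N i))) (lam : G → G → ZMod 2) (i j : ι) : ZMod 2 :=
  lam (gen φ i) (gen φ j) - lam (gen φ j) (gen φ i)

/-- Type-I: all `Ω_ij` vanish. -/
def IsTypeI (φ : G ≃* Multiplicative (∀ i, ZMod (N i))) (lam : G → G → ZMod 2) : Prop :=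
  ∀ i j, Omega2 φ lam i j = 0

/-- The `i`-th coordinate `a_i ∈ ℤ/N_i` of a group element. -/
def coord (φ : G ≃* Multiplicative (∀ i, ZMod (N i))) (i : ι) (g : G) : ZMod (N i) :=
  (Multiplicative.toAdd (φ g)) i

/-- The root cocycle `w_i(a,b) = (a_i + b_i - [a_i + b_i]) / N_i`, an integer. -/
def rootCocycle (φ : G ≃* Multiplicative (∀ i, ZMod (N i))) (i : ι) (g h : G) : ℤ :=
  (((coord φ i g).val : ℤ) + (coord φ i h).val - (coord φ i g + coord φ i h).val) / N i

/-- The integral cochain `∑_i p_i w_i`, with `p_i ∈ {0, 1}` and no reduction modulo 2. -/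
def rootSum [Fintype ι] (φ : G ≃* Multiplicative (∀ i, ZMod (N i))) (p : ι → ZMod 2) :
    G → G → ℤ :=
  fun g h => ∑ i, ((p i).val : ℤ) * rootCocycle φ i g h

end Abelian

end ITO

end

/-! Type I makes `Λ = ∑ Ω_i w_i` an integral representative of `λ`, and over the reals `Λ = dx` with
`x = ∑ Ω_i a_i / N_i` (`phase`, `cast_rootSum`). Hence `Λ ∪ Λ = d(x ∪ Λ)`, and its exponential is a
coboundary for every `ν`.

That `Λ mod 2` is cohomologous to `λ` is a splitting statement: the central extension defined by
their difference is split by lifting the generators to commuting elements `e_i` with `e_i ^ N_i = 1`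
(`exists_eq_d1_of_gen`).

For any integral `L = dx`, take the anyon `v ^ L`. Its obstruction is computed from `W = L - 4m`
with `m = ⌊L/4⌋`. It differs from `exp(iνπ(L ∪ L)/8)` by a sign, because `ν/2` is odd, and that sign
is the coboundary of `(-1)^(m ∪₁ L)` (`isCoboundary4_O4ofAnyon`). Since `⌊L/2⌋` solves the
second-layer equation (`d2_half`), each such `L` gives a valid order for `L mod 2`. Every cocycle in
the class of `λ` is such a reduction, and replacing `x` by its fractional part gives an `L` with
values in `{0, 1}`. -/

namespace ITO

/-! ### Obstructions of integral cocycles that are real coboundaries. -/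

section Integral

variable {G : Type*}

theorem val_intCast_two (n : ℤ) : (((n : ZMod 2).val : ℕ) : ℤ) = n - 2 * (n / 2) := by
  rw [ZMod.val_intCast]
  push_cast
  omega

/-- `L mod 4 = (L mod 2) + 2 ⌊L / 2⌋`. -/
theorem fracAnyon_intCast (L : G → G → ℤ) :
    fracAnyon (fun g h => (L g h : ZMod 2)) (fun g h => ((L g h / 2 : ℤ) : ZMod 2))
      = fun g h => (L g h : ZMod 4) := by
  funext g h
  have h1 := val_intCast_two (L g h)
  have h2 := val_intCast_two (L g h / 2)
  rw [fracAnyon, ← Int.cast_natCast, ZMod.intCast_eq_intCast_iff]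
  push_cast
  rw [h1, h2]
  exact (Int.modEq_iff_dvd).2 ⟨L g h / 2 / 2, by ring⟩

variable [Group G]

theorem circleExp_eq_of_sub_eq {x y : ℝ} (m : ℤ) (h : x = y + m * (2 * Real.pi)) :
    Circle.exp x = Circle.exp y :=
  Circle.exp_eq_exp.2 ⟨m, h⟩

/-- A 1-cochain coboundary is a 2-cocycle. -/
theorem d2_d1 {M : Type*} [AddCommGroup M] (f : G → M) (g h k : G) : d2 (d1 f) g h k = 0 := by
  simp only [d2, d1, mul_assoc]
  abel

/-- An integral cochain that is a real coboundary is a cocycle. -/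
theorem d2_eq_zero_of_real {L : G → G → ℤ} {x : G → ℝ} (hL : ∀ g h, (L g h : ℝ) = d1 x g h)
    (g h k : G) : d2 L g h k = 0 := by
  have := d2_d1 x g h k
  simp only [d2, ← hL] at this
  simp only [d2]
  exact_mod_cast this

/-- The coboundary of a 3-cochain of angles. -/
theorem isCoboundary4_of_angle {ω : G → G → G → G → Circle} (A : G → G → G → ℝ)
    (hA : ∀ g h k l, ω g h k l = Circle.exp
      (A h k l - A (g * h) k l + A g (h * k) l - A g h (k * l) + A g h k)) :
    IsCoboundary4 ω := by
  refine ⟨fun g h k => Circle.exp (A g h k), fun g h k l => ?_⟩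
  rw [hA]
  simp only [← Circle.exp_neg, ← Circle.exp_add, sub_eq_add_neg]

theorem isCoboundary4_expCupSq (ν : ℤ) {L : G → G → ℤ} {x : G → ℝ}
    (hL : ∀ g h, (L g h : ℝ) = d1 x g h) : IsCoboundary4 (expCupSq ν L) := by
  -- `d(x ∪ L) = dx ∪ L - x ∪ dL = L ∪ L`.
  refine isCoboundary4_of_angle (fun g h k => ν * Real.pi / 8 * (x g * L h k)) fun g h k l => ?_
  simp only [expCupSq]
  congr 1
  have h1 := hL g h
  have h2 : ((d2 L h k l : ℤ) : ℝ) = 0 := by exact_mod_cast d2_eq_zero_of_real hL h k l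
  simp only [d1] at h1
  simp only [d2] at h2
  push_cast at h2
  linear_combination (ν * Real.pi / 8) * ((L k l : ℝ) * h1 + x g * h2)

/-- The obstruction of an anyon-valued cocycle `w`: the cup square plus `dW ∪₁ W`, where `W` is the
lift of `w` to `{0, 1, 2, 3}`. -/
theorem O4ofAnyon_eq (ν : ℤ) {w : G → G → ZMod 4} (hw : ∀ g h k, d2 w g h k = 0)
    {W : G → G → ℤ} (hW : ∀ g h, W g h = (w g h).val) (g h k l : G) :
    O4ofAnyon ν w g h k l = Circle.exp (Real.pi * ν / 8 *
      ((W k l * W g h - W h k * d2 W g (h * k) l + W g h * d2 W (g * h) k l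
        + W k l * d2 W g h (k * l) : ℤ) : ℝ)) := by
  have hr : ∀ g h, (W g h : ℝ) = ((w g h).val : ℝ) := fun g h => by rw [hW]; simp
  -- Since `w` is a cocycle, both `F` symbols in each quotient have the same sum `y + z`, so the
  -- residues `[y + z]` cancel and a polynomial in `W` remains.
  have e1 : w g (h * k) + w (g * h * k) l = w (h * k) l + w g (h * k * l) := by
    have := hw g (h * k) l
    simp only [d2, mul_assoc] at this ⊢
    linear_combination -this
  have e2 : w k l + w (g * h) (k * l) = w (g * h) k + w (g * h * k) l := by
    have := hw (g * h) k l
    simp only [d2, mul_assoc] at this ⊢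
    linear_combination this
  have e3 : w h (k * l) + w g (h * k * l) = w g h + w (g * h) (k * l) := by
    have := hw g h (k * l)
    simp only [d2, mul_assoc] at this ⊢
    linear_combination this
  simp only [O4ofAnyon, Rsymbol, Fsymbol, ← Circle.exp_add, ← Circle.exp_sub]
  congr 1
  rw [e1, e2, e3]
  simp only [d2]
  push_cast
  simp only [hr, mul_assoc]
  ring

theorem d2_intCast {R : Type*} [Ring R] {L : G → G → ℤ} (hL : ∀ g h k, d2 L g h k = 0)
    (g h k : G) : d2 (fun a b => (L a b : R)) g h k = 0 := by
  have := congrArg (Int.cast : ℤ → R) (hL g h k)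
  simpa [d2] using this

theorem val_intCast_four (n : ℤ) : (((n : ZMod 4).val : ℕ) : ℤ) = n - 4 * (n / 4) := by
  rw [ZMod.val_intCast]
  push_cast
  omega

/-- In this range `L` is its own lift `W`, and `dL = 0` removes the cup-1 terms. -/
theorem O4ofAnyon_eq_expCupSq (ν : ℤ) {L : G → G → ℤ} (hL : ∀ g h k, d2 L g h k = 0)
    (h0 : ∀ g h, 0 ≤ L g h) (h4 : ∀ g h, L g h < 4) :
    O4ofAnyon ν (fun g h => (L g h : ZMod 4)) = expCupSq ν L := by
  have hW : ∀ g h, L g h = ((L g h : ZMod 4).val : ℤ) := fun g h => by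
    rw [val_intCast_four, Int.ediv_eq_zero_of_lt (h0 g h) (h4 g h)]; simp
  funext g h k l
  rw [O4ofAnyon_eq ν (d2_intCast hL) hW, hL, hL, hL, expCupSq]
  congr 1
  push_cast
  ring

/-- For `ν ≡ 2 mod 4`, the obstruction of the fractionalization `v ^ L` vanishes when the integral
cocycle `L` is a real coboundary. -/
theorem isCoboundary4_O4ofAnyon {k₀ ν : ℤ} (hν : ν = 4 * k₀ + 2) {L : G → G → ℤ} {x : G → ℝ}
    (hL : ∀ g h, (L g h : ℝ) = d1 x g h) :
    IsCoboundary4 (O4ofAnyon ν fun g h => (L g h : ZMod 4)) := by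
  have hc := d2_eq_zero_of_real hL
  set m : G → G → ℤ := fun g h => L g h / 4 with hm
  have hW : ∀ g h, L g h - 4 * m g h = ((L g h : ZMod 4).val : ℤ) := fun g h =>
    (val_intCast_four _).symm
  refine isCoboundary4_of_angle (fun g h k => ν * Real.pi / 8 * (x g * L h k)
    + Real.pi * ((m (g * h) k * L g h + m g (h * k) * L h k : ℤ) : ℝ)) fun g h k l => ?_
  rw [O4ofAnyon_eq ν (d2_intCast hc) (W := fun a b => L a b - 4 * m a b) hW]
  have hd : ∀ a b c, d2 (fun a b => L a b - 4 * m a b) a b c = -4 * d2 m a b c := by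
    intro a b c
    have := hc a b c
    simp only [d2] at this ⊢
    linear_combination this
  rw [hd, hd, hd]
  -- The exponent for `W = L - 4m` is `L ∪ L + 4T`; as `ν/2 = 2k₀ + 1`, the second term contributes
  -- the sign `(-1)^T`.
  set T : ℤ := -(m k l * L g h) - L k l * m g h + 4 * m k l * m g h
    + (L h k - 4 * m h k) * d2 m g (h * k) l - (L g h - 4 * m g h) * d2 m (g * h) k l
    - (L k l - 4 * m k l) * d2 m g h (k * l) with hT
  -- `B` is `m ∪₁ L`. Modulo 2, `T = m ∪ L + L ∪ m + dm ∪₁ L`, so the Hirsch formula `d(m ∪₁ L) = m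
  -- ∪ L + L ∪ m + dm ∪₁ L + m ∪₁ dL` gives `T ≡ dB`; the two cocycle identities below remove `m ∪₁
  -- dL`.
  set B : G → G → G → ℤ := fun g h k => m (g * h) k * L g h + m g (h * k) * L h k with hB
  set D : ℤ := B h k l - B (g * h) k l + B g (h * k) l - B g h (k * l) + B g h k with hD
  have key : ∃ j : ℤ, (2 * k₀ + 1) * T - D = 2 * j := by
    have h2 : (((2 * k₀ + 1) * T - D : ℤ) : ZMod 2) = 0 := by
      have c1 : ((d2 L g h k : ℤ) : ZMod 2) = 0 := by rw [hc]; simp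
      have c2 : ((d2 L h k l : ℤ) : ZMod 2) = 0 := by rw [hc]; simp
      simp only [hD, hT, hB, d2, mul_assoc] at c1 c2 ⊢
      push_cast at c1 c2 ⊢
      linear_combination (norm := (ring_nf; reduce_mod_char))
        (m (g * (h * k)) l : ZMod 2) * c1 + (m g (h * (k * l)) : ZMod 2) * c2
    exact (ZMod.intCast_zmod_eq_zero_iff_dvd _ 2).1 h2
  obtain ⟨j, hj⟩ := key
  refine circleExp_eq_of_sub_eq j ?_
  have hj' : (2 * (k₀ : ℝ) + 1) * T - D = 2 * j := by exact_mod_cast hj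
  have h1 := hL g h
  have h2 : ((d2 L h k l : ℤ) : ℝ) = 0 := by exact_mod_cast hc h k l
  simp only [d1] at h1
  simp only [d2] at h2
  push_cast at h2
  have hDr : (D : ℝ) = B h k l - B (g * h) k l + B g (h * k) l - B g h (k * l) + B g h k := by
    simp [hD]
  have hTr : (((L k l - 4 * m k l) * (L g h - 4 * m g h) - (L h k - 4 * m h k) *
      (-4 * d2 m g (h * k) l) + (L g h - 4 * m g h) * (-4 * d2 m (g * h) k l) +
      (L k l - 4 * m k l) * (-4 * d2 m g h (k * l)) : ℤ) : ℝ) = L g h * L k l + 4 * T := by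
    rw [hT]; push_cast; ring
  have hνr : (ν : ℝ) = 4 * k₀ + 2 := by rw [hν]; push_cast; ring
  rw [hTr]
  linear_combination (ν * Real.pi / 8) * ((L k l : ℝ) * h1 + x g * h2) + Real.pi * hj'
    + Real.pi * hDr + Real.pi / 2 * T * hνr

/-- `⌊L / 2⌋` trivializes the cup-1 square of `L mod 2`. -/
theorem d2_half {L : G → G → ℤ} (hL : ∀ g h k, d2 L g h k = 0) (g h k : G) :
    d2 (fun a b => ((L a b / 2 : ℤ) : ZMod 2)) g h k
      = cupOneSq (fun a b => (L a b : ZMod 2)) g h k := by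
  -- Compare the second binary digits in `a + c = b + d`: the last bits `r, t` of `a, c` carry `r
  -- t`, and `s, u` of `b, d` carry `s u`.
  have key : ∀ a b c d : ℤ, a - b + c - d = 0 →
      ((a / 2 : ℤ) : ZMod 2) - ((b / 2 : ℤ) : ZMod 2) + ((c / 2 : ℤ) : ZMod 2)
        - ((d / 2 : ℤ) : ZMod 2) = (a : ZMod 2) * c - d * b := by
    intro a b c d habcd
    have hp : ∀ n : ℤ, ∃ q r : ℤ, n = 2 * q + r ∧ n / 2 = q ∧ (r = 0 ∨ r = 1) := fun n =>
      ⟨n / 2, n % 2, by omega, rfl, by omega⟩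
    obtain ⟨a', r, ha, ea, hr⟩ := hp a
    obtain ⟨b', s, hb, eb, hs⟩ := hp b
    obtain ⟨c', t, hc, ec, ht⟩ := hp c
    obtain ⟨d', u, hd, ed, hu⟩ := hp d
    rw [ea, eb, ec, ed, ha, hb, hc, hd, ← sub_eq_zero]
    suffices H : 2 ∣ (a' - b' + c' - d' - (r * t - u * s)) by
      have := (ZMod.intCast_zmod_eq_zero_iff_dvd _ 2).2 H
      push_cast at this ⊢
      linear_combination (norm := (ring_nf; reduce_mod_char)) this
    rcases hr with rfl | rfl <;> rcases hs with rfl | rfl <;> rcases ht with rfl | rfl <;>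
      rcases hu with rfl | rfl <;> omega
  have := hL g h k
  simp only [d2] at this
  simpa only [d2, cupOneSq] using key _ _ _ _ this

theorem O4B_zero (lam : G → G → ZMod 2) (g h k l : G) : O4B lam 0 g h k l = 1 := by
  simp [O4B, signExponentB, d2]

theorem O3_zero {k₀ ν : ℤ} (hν : ν = 4 * k₀ + 2) (lam : G → G → ZMod 2) (g h k : G) :
    O3 ν lam 0 g h k = cupOneSq lam g h k := by
  have h2 : ν / 2 = 2 * k₀ + 1 := by omega
  have h3 : ((2 * k₀ + 1 : ℤ) : ZMod 2) = 1 := by push_cast; reduce_mod_char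
  rw [O3, h2, h3]
  simp [cup21]

/-- The enriched order with fractionalization anyon `v ^ L`. -/
def enrichedOfIntegral {k₀ ν : ℤ} (hν : ν = 4 * k₀ + 2) {L : G → G → ℤ} {x : G → ℝ}
    (hL : ∀ g h, (L g h : ℝ) = d1 x g h) : EnrichedITO ν (fun g h => (L g h : ZMod 2)) where
  n1 := 0
  n2A := fun g h => ((L g h / 2 : ℤ) : ZMod 2)
  n2B := 0
  d_n1 g h := by
    have : (ν : ZMod 2) = 0 := by rw [hν]; push_cast; reduce_mod_char
    simp [d1, O2, this]
  d_n2A g h k := by rw [O3_zero hν, d2_half (d2_eq_zero_of_real hL)]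
  d_n2B g h k := by simp [d2, O3, cup21]
  O4_trivial := by
    simp only [O4B_zero, mul_one, O4A, fracAnyon_intCast]
    exact isCoboundary4_O4ofAnyon hν hL

/-- A function of the group elements whose coboundary is integral may be replaced by its fractional
part; the coboundary then takes values in `{0, 1}`. -/
theorem exists_integral_fract {L : G → G → ℤ} {x : G → ℝ} (hL : ∀ g h, (L g h : ℝ) = d1 x g h) :
    ∃ L' : G → G → ℤ, (∀ g h, (L' g h : ℝ) = d1 (fun g => Int.fract (x g)) g h) ∧
      (∀ g h, L' g h = L g h + d1 (fun g => -⌊x g⌋) g h) ∧ ∀ g h, L' g h = 0 ∨ L' g h = 1 := by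
  refine ⟨fun g h => L g h + d1 (fun g => -⌊x g⌋) g h, ?_, fun _ _ => rfl, ?_⟩
  · intro g h
    push_cast [d1, hL]
    simp only [Int.fract]
    ring
  · intro g h
    have e : ((L g h + d1 (fun g => -⌊x g⌋) g h : ℤ) : ℝ) = d1 (fun g => Int.fract (x g)) g h := by
      push_cast [d1, hL]
      simp only [Int.fract]
      ring
    change L g h + d1 (fun g => -⌊x g⌋) g h = 0 ∨ L g h + d1 (fun g => -⌊x g⌋) g h = 1
    generalize L g h + d1 (fun g => -⌊x g⌋) g h = n at e ⊢
    simp only [d1] at e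
    have := Int.fract_nonneg (x g)
    have := Int.fract_nonneg (x h)
    have := Int.fract_nonneg (x (g * h))
    have := Int.fract_lt_one (x g)
    have := Int.fract_lt_one (x h)
    have := Int.fract_lt_one (x (g * h))
    -- A sum of two numbers in `[0, 1)` minus a third lies in `(-1, 2)`, where the only integers are
    -- 0 and 1.
    have l1 : (-1 : ℝ) < n := by linarith
    have l2 : (n : ℝ) < 2 := by linarith
    have l1' : -1 < n := by exact_mod_cast l1
    have l2' : n < 2 := by exact_mod_cast l2
    omega

end Integral

/-! ### Central extensions and their splittings. -/

section Extension

variable {G : Type*} [Group G] {A : Type*} [AddCommGroup A]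

/-- The underlying type of the central extension of `G` by `A` with cocycle `μ`. -/
@[ext]
structure CentralExt (μ : G → G → A) where
  /-- the component in the kernel -/
  fst : A
  /-- the image in the quotient -/
  snd : G

theorem IsCocycle2.one_left {μ : G → G → A} (hμ : IsCocycle2 μ) (g : G) : μ 1 g = μ 1 1 := by
  have := hμ 1 1 g
  simp only [d2, one_mul, sub_self, zero_add] at this
  exact sub_eq_zero.1 this

instance (μ : G → G → A) : Mul (CentralExt μ) :=
  ⟨fun x y => ⟨x.fst + y.fst + μ x.snd y.snd, x.snd * y.snd⟩⟩

/-- The cocycle need not be normalized, hence the shift by `μ 1 1` here and in the inverse. -/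
instance (μ : G → G → A) : One (CentralExt μ) := ⟨⟨-μ 1 1, 1⟩⟩

instance (μ : G → G → A) : Inv (CentralExt μ) :=
  ⟨fun x => ⟨-x.fst - μ x.snd⁻¹ x.snd - μ 1 1, x.snd⁻¹⟩⟩

/-- The group structure on a central extension. -/
@[reducible]
def centralExtGroup {μ : G → G → A} (hμ : IsCocycle2 μ) : Group (CentralExt μ) :=
  Group.ofLeftAxioms
    (by
      rintro ⟨a, g⟩ ⟨b, h⟩ ⟨c, k⟩
      have := hμ g h k
      simp only [d2] at this
      refine CentralExt.ext ?_ (mul_assoc g h k)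
      change a + b + μ g h + c + μ (g * h) k = a + (b + c + μ h k) + μ g (h * k)
      rw [← sub_eq_zero, ← neg_eq_zero, ← this]
      abel)
    (by
      rintro ⟨a, g⟩
      refine CentralExt.ext ?_ (one_mul g)
      change -μ 1 1 + a + μ 1 g = a
      rw [hμ.one_left g, neg_add_eq_sub, sub_add_cancel])
    (by
      rintro ⟨a, g⟩
      refine CentralExt.ext ?_ (inv_mul_cancel g)
      change -a - μ g⁻¹ g - μ 1 1 + a + μ g⁻¹ g = -μ 1 1
      abel)

/-- A cocycle is a coboundary when the extension that it defines splits. -/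
theorem eq_d1_of_section {μ : G → G → A} (hμ : IsCocycle2 μ) :
    let _ := centralExtGroup hμ
    ∀ s : G →* CentralExt μ, (∀ g, (s g).snd = g) → ∃ ε : G → A, ∀ g h, μ g h = d1 ε g h := by
  intro _ s hs
  refine ⟨fun g => -(s g).fst, fun g h => ?_⟩
  have : (s (g * h)).fst = (s g).fst + (s h).fst + μ (s g).snd (s h).snd :=
    congrArg CentralExt.fst (s.map_mul g h)
  rw [hs, hs] at this
  simp only [d1, this]
  abel

end Extension

/-! ### Cocycles on products of cyclic groups. -/

section Abelian

variable {ι : Type*} [Fintype ι] [DecidableEq ι] {N : ι → ℕ} {G : Type*} [CommGroup G]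
  {A : Type*} [AddCommGroup A]

omit [Fintype ι] in
theorem gen_pow (φ : G ≃* Multiplicative (∀ i, ZMod (N i))) (i : ι) : gen φ i ^ N i = 1 := by
  rw [gen, ← map_pow, ← ofAdd_nsmul, ← Pi.single_smul]
  simp

/-- A 2-cocycle on a finite abelian group that is symmetric on generators, and whose restriction to
the cyclic factors is trivial, is a coboundary. -/
theorem exists_eq_d1_of_gen (φ : G ≃* Multiplicative (∀ i, ZMod (N i))) {μ : G → G → A}
    (hμ : IsCocycle2 μ) (hsymm : ∀ i j, μ (gen φ i) (gen φ j) = μ (gen φ j) (gen φ i))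
    (a : ι → A) (ha : ∀ i, N i • a i + ∑ n ∈ Finset.range (N i), μ (gen φ i ^ n) (gen φ i) = 0) :
    ∃ ε : G → A, ∀ g h, μ g h = d1 ε g h := by
  let _ := centralExtGroup hμ
  -- The coefficient `a i` is the freedom in lifting a generator; `ha` is exactly the condition `e i
  -- ^ N i = 1`.
  let e : ι → CentralExt μ := fun i => ⟨a i, gen φ i⟩
  have hpow : ∀ i (n : ℕ), e i ^ n =
      ⟨n • a i - μ 1 1 + ∑ m ∈ Finset.range n, μ (gen φ i ^ m) (gen φ i), gen φ i ^ n⟩ := by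
    intro i n
    induction n with
    | zero =>
      refine CentralExt.ext ?_ (pow_zero _).symm
      change -μ 1 1 = _
      simp
    | succ n ih =>
      rw [pow_succ, ih]
      refine CentralExt.ext ?_ (pow_succ _ _).symm
      change n • a i - μ 1 1 + ∑ m ∈ Finset.range n, μ (gen φ i ^ m) (gen φ i) + a i
        + μ (gen φ i ^ n) (gen φ i) = _
      simp only [Finset.sum_range_succ, succ_nsmul]
      abel
  have hN : ∀ i, e i ^ N i = 1 := by
    intro i
    rw [hpow]
    refine CentralExt.ext ?_ (gen_pow φ i)
    change N i • a i - μ 1 1 + _ = -μ 1 1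
    rw [sub_add_eq_add_sub, ha, zero_sub]
  have hcomm : ∀ i j, AddCommute (Additive.ofMul (e i)) (Additive.ofMul (e j)) := by
    intro i j
    refine congrArg Additive.ofMul (?_ : e i * e j = e j * e i)
    refine CentralExt.ext ?_ (mul_comm _ _)
    change a i + a j + μ (gen φ i) (gen φ j) = a j + a i + μ (gen φ j) (gen φ i)
    rw [hsymm, add_comm (a i)]
  let ψ : ∀ i, ZMod (N i) →+ Additive (CentralExt μ) := fun i =>
    ZMod.lift (N i) ⟨zmultiplesHom _ (Additive.ofMul (e i)), by
      simp [← ofMul_pow, hN]⟩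
  have hψ : ∀ i (n : ℤ), ψ i n = n • Additive.ofMul (e i) := fun i n => by
    simp [ψ, ZMod.lift_coe]
  have hψc : Pairwise fun i j => ∀ x y, AddCommute (ψ i x) (ψ j y) := by
    intro i j _ x y
    obtain ⟨m, rfl⟩ := ZMod.intCast_surjective x
    obtain ⟨n, rfl⟩ := ZMod.intCast_surjective y
    rw [hψ, hψ]
    exact AddCommute.zsmul_left (AddCommute.zsmul_right (hcomm i j) n) m
  let Ψ := AddMonoidHom.noncommPiCoprod ψ hψc
  let s : G →* CentralExt μ := (AddMonoidHom.toMultiplicativeLeft Ψ).comp φ.toMonoidHom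
  let p : CentralExt μ →* G :=
    { toFun := CentralExt.snd, map_one' := rfl, map_mul' := fun _ _ => rfl }
  -- That `s` is a section need only be checked on the cyclic factors, where it holds by the choice
  -- of `e i`.
  have hp : MonoidHom.toAdditiveRight φ.symm.toMonoidHom = (MonoidHom.toAdditive p).comp Ψ := by
    refine AddMonoidHom.functions_ext' _ _ _ fun i => AddMonoidHom.ext fun y => ?_
    obtain ⟨n, rfl⟩ := ZMod.intCast_surjective y
    have h1 : Ψ (Pi.single i (n : ZMod (N i))) = n • Additive.ofMul (e i) := by
      rw [AddMonoidHom.noncommPiCoprod_single, hψ]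
    have h2 : (Pi.single i (n : ZMod (N i)) : ∀ i, ZMod (N i)) = n • Pi.single i 1 := by
      rw [← Pi.single_smul, zsmul_one]
    simp only [AddMonoidHom.comp_apply, AddMonoidHom.single_apply]
    rw [h1, map_zsmul, h2, map_zsmul]
    rfl
  refine eq_d1_of_section hμ s fun g => ?_
  have := DFunLike.congr_fun hp (φ g).toAdd
  exact this.symm.trans (φ.symm_apply_apply g)

/-- The real cochain `∑ p_i a_i / N_i`, with coboundary `rootSum`. -/
noncomputable def phase (φ : G ≃* Multiplicative (∀ i, ZMod (N i))) (p : ι → ZMod 2) (g : G) : ℝ :=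
  ∑ i, ((p i).val : ℝ) * (((coord φ i g).val : ℝ) / N i)

omit [Fintype ι] [DecidableEq ι] in
theorem coord_mul (φ : G ≃* Multiplicative (∀ i, ZMod (N i))) (i : ι) (g h : G) :
    coord φ i (g * h) = coord φ i g + coord φ i h := by
  simp [coord]

omit [DecidableEq ι] in
theorem rootSum_comm (φ : G ≃* Multiplicative (∀ i, ZMod (N i))) (p : ι → ZMod 2) (g h : G) :
    rootSum φ p g h = rootSum φ p h g := by
  simp only [rootSum, rootCocycle, add_comm]

omit [Fintype ι] in
theorem coord_gen (φ : G ≃* Multiplicative (∀ i, ZMod (N i))) (i j : ι) :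
    coord φ j (gen φ i) = (Pi.single i 1 : ∀ i, ZMod (N i)) j := by
  simp [coord, gen]

variable [∀ i, NeZero (N i)]

omit [Fintype ι] [DecidableEq ι] in
theorem rootCocycle_eq (φ : G ≃* Multiplicative (∀ i, ZMod (N i))) (i : ι) (g h : G) :
    rootCocycle φ i g h = (((coord φ i g).val + (coord φ i h).val) / N i : ℕ) := by
  have hN : (N i : ℤ) ≠ 0 := by exact_mod_cast NeZero.ne (N i)
  rw [rootCocycle, ZMod.val_add]
  refine Int.ediv_eq_of_eq_mul_right hN ?_
  have := Nat.div_add_mod ((coord φ i g).val + (coord φ i h).val) (N i)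
  zify at this ⊢
  linear_combination -this

omit [Fintype ι] [DecidableEq ι] in
theorem cast_rootCocycle (φ : G ≃* Multiplicative (∀ i, ZMod (N i))) (i : ι) (g h : G) :
    (rootCocycle φ i g h : ℝ) = d1 (fun a => ((coord φ i a).val : ℝ) / N i) g h := by
  have hN : (N i : ℝ) ≠ 0 := by exact_mod_cast NeZero.ne (N i)
  have := Nat.div_add_mod ((coord φ i g).val + (coord φ i h).val) (N i)
  rw [← ZMod.val_add, ← coord_mul] at this
  rw [rootCocycle_eq]
  simp only [d1]
  field_simp
  have h' : (N i : ℝ) * (((coord φ i g).val + (coord φ i h).val) / N i : ℕ)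
    + (coord φ i (g * h)).val = (coord φ i g).val + (coord φ i h).val := by exact_mod_cast this
  linear_combination h'

omit [DecidableEq ι] in
theorem cast_rootSum (φ : G ≃* Multiplicative (∀ i, ZMod (N i))) (p : ι → ZMod 2) (g h : G) :
    (rootSum φ p g h : ℝ) = d1 (phase φ p) g h := by
  simp only [rootSum, phase, d1, ← Finset.sum_sub_distrib, ← Finset.sum_add_distrib]
  push_cast
  refine Finset.sum_congr rfl fun i _ => ?_
  rw [cast_rootCocycle]
  simp only [d1]
  ring

omit [DecidableEq ι] in
theorem rootSum_nonneg (φ : G ≃* Multiplicative (∀ i, ZMod (N i))) (p : ι → ZMod 2) (g h : G) :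
    0 ≤ rootSum φ p g h :=
  Finset.sum_nonneg fun i _ => by rw [rootCocycle_eq]; positivity

/-- The sum of the real coboundaries telescopes. The factor `(1 : ZMod (N i)).val` is 1 except when
`N i = 1`, where it is 0. -/
theorem sum_rootSum_gen (φ : G ≃* Multiplicative (∀ i, ZMod (N i))) (p : ι → ZMod 2) (i : ι) :
    ∑ n ∈ Finset.range (N i), rootSum φ p (gen φ i ^ n) (gen φ i)
      = (p i).val * (1 : ZMod (N i)).val := by
  have hN : (N i : ℝ) ≠ 0 := by exact_mod_cast NeZero.ne (N i)
  have h1 : phase φ p (gen φ i) = (p i).val * ((1 : ZMod (N i)).val / N i) := by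
    rw [phase, Finset.sum_eq_single i]
    · rw [coord_gen, Pi.single_eq_same]
    · intro j _ hj
      rw [coord_gen, Pi.single_eq_of_ne hj]
      simp
    · simp
  have h2 : ∀ n : ℕ, ∑ m ∈ Finset.range n, d1 (phase φ p) (gen φ i ^ m) (gen φ i)
      = n * phase φ p (gen φ i) + phase φ p 1 - phase φ p (gen φ i ^ n) := by
    intro n
    induction n with
    | zero => simp
    | succ n ih =>
      rw [Finset.sum_range_succ, ih]
      simp only [d1, pow_succ]
      push_cast
      ring
  have h3 := h2 (N i)
  simp only [← cast_rootSum] at h3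
  rw [gen_pow, h1] at h3
  have h4 : (N i : ℝ) * ((p i).val * ((1 : ZMod (N i)).val / N i)) + phase φ p 1 - phase φ p 1
      = (p i).val * (1 : ZMod (N i)).val := by
    field_simp
    ring
  rw [h4] at h3
  exact_mod_cast h3

/-- A type-I cocycle is cohomologous to the reduction of `∑ Ω_i w_i`. -/
theorem cohomologous2_rootSum (φ : G ≃* Multiplicative (∀ i, ZMod (N i))) {lam : G → G → ZMod 2}
    (hlam : IsCocycle2 lam) (hI : IsTypeI φ lam) :
    Cohomologous2 lam fun g h => (rootSum φ (Omega1 φ lam) g h : ZMod 2) := by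
  set L := rootSum φ (Omega1 φ lam) with hLdef
  have hL : ∀ g h k, d2 L g h k = 0 := d2_eq_zero_of_real (cast_rootSum φ _)
  have hμ : IsCocycle2 fun g h => (L g h : ZMod 2) - lam g h := by
    intro g h k
    have h1 := hlam g h k
    have h2 := d2_intCast (R := ZMod 2) hL g h k
    simp only [d2] at h1 h2 ⊢
    linear_combination h2 - h1
  obtain ⟨ε, hε⟩ := exists_eq_d1_of_gen φ hμ (fun i j => by
      rw [hLdef, rootSum_comm, sub_eq_zero.1 (hI i j)])
    -- For `N i > 1` the two invariants agree and no correction is needed. For a trivial factor the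
    -- root cocycle vanishes while `Ω_i = λ(1,1)` may not; the lift of the generator absorbs it.
    (fun i => if N i = 1 then Omega1 φ lam i else 0) (fun i => by
      have h1 : ((∑ n ∈ Finset.range (N i), L (gen φ i ^ n) (gen φ i) : ℤ) : ZMod 2)
          = Omega1 φ lam i * (1 : ZMod (N i)).val := by
        rw [hLdef, sum_rootSum_gen]
        simp
      push_cast at h1
      have h2 : ∑ n ∈ Finset.range (N i), lam (gen φ i ^ n) (gen φ i) = Omega1 φ lam i := rfl
      rw [Finset.sum_sub_distrib, h1, h2]
      split_ifs with h
      · rw [ZMod.val_one_eq_one_mod, h]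
        simpa using CharTwo.add_self_eq_zero _
      · rw [ZMod.val_one_eq_one_mod, Nat.mod_eq_of_lt]
        · simp
        · have := NeZero.pos (N i)
          omega)
  exact ⟨ε, fun g h => by rw [← hε]; ring⟩

end Abelian

/-! ### Changing the representative within a cohomology class. -/

section Existence

variable {G : Type*} [Group G]

theorem Cohomologous2.symm {M : Type*} [AddCommGroup M] {f f' : G → G → M}
    (h : Cohomologous2 f f') : Cohomologous2 f' f := by
  obtain ⟨ε, hε⟩ := h
  exact ⟨fun g => -ε g, fun g h => by rw [hε]; simp only [d1]; abel⟩

theorem Cohomologous2.trans {M : Type*} [AddCommGroup M] {f f' f'' : G → G → M}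
    (h : Cohomologous2 f f') (h' : Cohomologous2 f' f'') : Cohomologous2 f f'' := by
  obtain ⟨ε, hε⟩ := h
  obtain ⟨ε', hε'⟩ := h'
  exact ⟨fun g => ε g + ε' g, fun g h => by rw [hε', hε]; simp only [d1]; abel⟩

theorem cohomologous2_intCast {R : Type*} [Ring R] {L L' : G → G → ℤ} (h : Cohomologous2 L L') :
    Cohomologous2 (fun g h => (L g h : R)) fun g h => (L' g h : R) := by
  obtain ⟨ε, hε⟩ := h
  exact ⟨fun g => (ε g : R), fun g h => by simp [hε, d1]⟩

/-- A `ℤ/2`-valued cochain that is cohomologous to the reduction of an integral real coboundary is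
itself such a reduction. -/
theorem exists_integral_lift {L : G → G → ℤ} {x : G → ℝ} (hL : ∀ g h, (L g h : ℝ) = d1 x g h)
    {lam : G → G → ZMod 2} (h : Cohomologous2 lam fun g h => (L g h : ZMod 2)) :
    ∃ (L' : G → G → ℤ) (x' : G → ℝ), (∀ g h, (L' g h : ℝ) = d1 x' g h) ∧
      lam = fun g h => (L' g h : ZMod 2) := by
  obtain ⟨ε, hε⟩ := h.symm
  -- Lift the `ℤ/2`-valued `ε` to integers and add it to `x`; the coboundary stays integral.
  refine ⟨fun g h => L g h + d1 (fun g => ((ε g).val : ℤ)) g h, fun g => x g + (ε g).val, ?_, ?_⟩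
  · intro g h
    push_cast [d1, hL]
    ring
  · funext g h
    rw [hε]
    simp [d1]

end Existence

end ITO

/-! ### The main theorem. -/

theorem mainTheorem9 {ι : Type*} [Fintype ι] [DecidableEq ι] (N : ι → ℕ) [∀ i, NeZero (N i)]
    {G : Type*} [CommGroup G] (φ : G ≃* Multiplicative (∀ i, ZMod (N i)))
    (k ν : ℤ) (hν : ν = 4 * k + 2)
    (lam : G → G → ZMod 2) (hlam : ITO.IsCocycle2 lam) (hI : ITO.IsTypeI φ lam) :
    -- no enforced symmetry breaking, and no Majorana data are needed
    ¬ ITO.ESB ν lam ∧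
    (∃ S : ITO.EnrichedITO ν lam, S.n1 = 0 ∧ S.n2B = 0) ∧
    -- a representative of the class of `λ` for which `n₁ = n₂ = 0` is a solution
    (∃ lam' : G → G → ZMod 2, ITO.IsCocycle2 lam' ∧ ITO.Cohomologous2 lam lam' ∧
      (∀ g h l, ITO.O3 ν lam' 0 g h l = 0) ∧
      ITO.O4A ν lam' 0 = ITO.expCupSq ν (ITO.lift01 lam') ∧
      ITO.IsCoboundary4 (ITO.expCupSq ν (ITO.lift01 lam')) ∧
      ∃ S : ITO.EnrichedITO ν lam', S.n1 = 0 ∧ S.n2A = 0 ∧ S.n2B = 0) ∧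
    -- the representative `Λ = ∑ Ω_i w_i`, with fractionalization anyon `v ^ Λ`
    (∃ (L : G → G → ℤ) (lam₀ n2 : G → G → ZMod 2),
      L = ITO.rootSum φ (ITO.Omega1 φ lam) ∧
      lam₀ = (fun g h => (L g h : ZMod 2)) ∧
      n2 = (fun g h => ((L g h / 2 : ℤ) : ZMod 2)) ∧
      ITO.Cohomologous2 lam lam₀ ∧
      (∀ g h l, ITO.d2 L g h l = 0) ∧
      ITO.IsCoboundary4 (ITO.expCupSq ν L) ∧
      (∀ g h, ITO.fracAnyon lam₀ n2 g h = (L g h : ZMod 4)) ∧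
      ((∀ g h, L g h < 4) → ITO.O4A ν lam₀ n2 = ITO.expCupSq ν L) ∧
      ∃ S : ITO.EnrichedITO ν lam₀, S.n1 = 0 ∧ S.n2A = n2 ∧ S.n2B = 0) := by
  have hL := ITO.cast_rootSum φ (ITO.Omega1 φ lam)
  have hcoh := ITO.cohomologous2_rootSum φ hlam hI
  have hex : ∃ S : ITO.EnrichedITO ν lam, S.n1 = 0 ∧ S.n2B = 0 := by
    obtain ⟨L', x', hL', rfl⟩ := ITO.exists_integral_lift hL hcoh
    exact ⟨ITO.enrichedOfIntegral hν hL', rfl, rfl⟩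
  refine ⟨?_, hex, ?_, ?_⟩
  · obtain ⟨S, -⟩ := hex
    exact fun hE => hE.false S
  -- The fractional part of the phase gives values in `{0, 1}`, so `⌊L'/2⌋ = 0` and `L'` is its own
  -- lift.
  · obtain ⟨L', hL', hd, h01⟩ := ITO.exists_integral_fract hL
    have hc := ITO.d2_eq_zero_of_real hL'
    have hlift : ITO.lift01 (fun g h => (L' g h : ZMod 2)) = L' := by
      funext g h
      rcases h01 g h with e | e <;> simp [ITO.lift01, e, ZMod.val_one]
    have hhalf : (fun g h => ((L' g h / 2 : ℤ) : ZMod 2)) = 0 := by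
      funext g h
      rcases h01 g h with e | e <;> simp [e]
    refine ⟨fun g h => (L' g h : ZMod 2), ITO.d2_intCast hc,
      hcoh.trans (ITO.cohomologous2_intCast ⟨_, hd⟩), fun g h l => ?_, ?_, ?_,
      ITO.enrichedOfIntegral hν hL', rfl, hhalf, rfl⟩
    · rw [ITO.O3_zero hν, ← ITO.d2_half hc, hhalf]
      simp [ITO.d2]
    · rw [hlift, ITO.O4A, ← hhalf, ITO.fracAnyon_intCast]
      refine ITO.O4ofAnyon_eq_expCupSq ν hc (fun g h => ?_) fun g h => ?_ <;>
        rcases h01 g h with e | e <;> simp [e]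
    · rw [hlift]
      exact ITO.isCoboundary4_expCupSq ν hL'
  · refine ⟨_, _, _, rfl, rfl, rfl, hcoh, ITO.d2_eq_zero_of_real hL,
      ITO.isCoboundary4_expCupSq ν hL, fun g h => ?_, fun h4 => ?_,
      ITO.enrichedOfIntegral hν hL, rfl, rfl, rfl⟩
    · rw [ITO.fracAnyon_intCast]
    · rw [ITO.O4A, ITO.fracAnyon_intCast]
      exact ITO.O4ofAnyon_eq_expCupSq ν (ITO.d2_eq_zero_of_real hL) (ITO.rootSum_nonneg φ _) h4
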